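/- Let $(\eta_j)_{j\in\mathbb Z}$ be independent identically distributed real random variables on a probability space $(\Omega,\mathcal A,\mathsf P)$ with $\mathsf E\eta_1=0$ and $0<\sigma_\eta^2:=\mathsf E\eta_1^2<\infty$ ($\sigma_\eta>0$), let $(\psi_j)_{j\ge 0}$ be real numbers with $\sum_{j\ge0}|\psi_j|<\infty$ and $A_\psi:=\sum_{j\ge0}\psi_j\neq 0$, and let $X_i=\sum_{j=0}^\infty\psi_j\eta_{i-j}$ (almost surely), $i\in\mathbb Z$, be the corresponding short-memory linear process. Let $\nu$ be an isonormal Gaussian process on $\mathcal L^2[0,1]$, that is, a centred Gaussian process $(\nu(f))_{f\in\mathcal L^2[0,1]}$, on some probability space, with $\mathsf E[\nu(f)\nu(h)]=\int_0^1 f(x)h(x)\,dx$ for all $f,h\in\mathcal L^2[0,1]$. Let $1\le q<2$ and let $g\colon[0,1]\to\mathbb R$ have bounded $q$-variation, i.e. $$\sup\Big\{\sum_{i=1}^m|g(t_i)-g(t_{i-1})|^q:\ 0=t_0<t_1<\dots<t_m=1,\ m\ge 1\Big\}<\infty .$$ Then $g\in\mathcal L^2[0,1]$ and, as $n\to\infty$,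 $$n^{-1/2}\sum_{i=1}^n X_i\,g\Big(\frac in\Big)\ \longrightarrow\ \sigma_\eta A_\psi\,\nu(g)\quad\text{in distribution,}$$ where the limit $\sigma_\eta A_\psi\,\nu(g)$ is a normal random variable with mean $0$ and variance $\sigma_\eta^2A_\psi^2\int_0^1 g(x)^2\,dx$ (equal to $0$ almost surely if this variance is $0$). -/

import Mathlib

open MeasureTheory ProbabilityTheory Filter Topology
open scoped ENNReal

noncomputable section

/-- Independent identically distributed innovations `(η_j)_{j ∈ ℤ}` with mean zero and finite
nonzero second moment. -/
structure IsInnovation {Ω : Type*} [MeasurableSpace Ω] (P : Measure Ω) (η : ℤ → Ω → ℝ) :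
    Prop where
  indep : iIndepFun η P
  identDistrib : ∀ j, IdentDistrib (η j) (η 1) P P
  memLp_two : MemLp (η 1) 2 P
  mean_zero : ∫ ω, η 1 ω ∂P = 0
  second_moment_ne_zero : ∫ ω, η 1 ω ^ 2 ∂P ≠ 0

/-- The standard deviation `σ_η` of the innovations, `σ_η² = E η_1²`. -/
def innovationStd {Ω : Type*} [MeasurableSpace Ω] (P : Measure Ω) (η : ℤ → Ω → ℝ) : ℝ :=
  √(∫ ω, η 1 ω ^ 2 ∂P)

/-- `X_i = ∑_{j ≥ 0} ψ_j η_{i-j}`, `i ∈ ℤ`, is a linear process with innovations `(η_j)` and square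
summable filter `(ψ_j)`; the series is the almost sure limit of its partial sums. -/
structure IsLinearProcess {Ω : Type*} [MeasurableSpace Ω] (P : Measure Ω) (η : ℤ → Ω → ℝ)
    (ψ : ℕ → ℝ) (X : ℤ → Ω → ℝ) : Prop where
  innovation : IsInnovation P η
  square_summable : Summable fun j => ψ j ^ 2
  series : ∀ i : ℤ, ∀ᵐ ω ∂P,
    Tendsto (fun N : ℕ => ∑ j ∈ Finset.range N, ψ j * η (i - j) ω) atTop (𝓝 (X i ω))

/-- The sum `A_ψ = ∑_{j ≥ 0} ψ_j` of the filter. -/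
def filterSum (ψ : ℕ → ℝ) : ℝ := ∑' j, ψ j

/-- A short-memory linear process: the filter is absolutely summable with `A_ψ ≠ 0`. -/
structure IsShortMemoryLinearProcess {Ω : Type*} [MeasurableSpace Ω] (P : Measure Ω)
    (η : ℤ → Ω → ℝ) (ψ : ℕ → ℝ) (X : ℤ → Ω → ℝ) : Prop extends IsLinearProcess P η ψ X where
  summable : Summable fun j => |ψ j|
  filterSum_ne_zero : filterSum ψ ≠ 0

/-- The weighted sum `ν_n(g) = ∑_{i=1}^n X_i g(i/n)`. -/
def weightedSum {Ω : Type*} (X : ℤ → Ω → ℝ) (g : ℝ → ℝ) (n : ℕ) (ω : Ω) : ℝ :=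
  ∑ i ∈ Finset.Icc 1 n, X (i : ℤ) ω * g ((i : ℝ) / n)

/-- The `p`-variation `v_p(g; [a, b])`, the supremum of `∑_{i=1}^m |g(t_i) - g(t_{i-1})|^p` over all
partitions `a = t_0 < t_1 < ⋯ < t_m = b` with `m ≥ 1`, possibly infinite. -/
def pVariation (p : ℝ) (g : ℝ → ℝ) (a b : ℝ) : ℝ≥0∞ :=
  ⨆ (m : ℕ) (t : ℕ → ℝ)
    (_ : 0 < m ∧ t 0 = a ∧ t m = b ∧ ∀ i < m, t i < t (i + 1)),
    ∑ i ∈ Finset.range m, ENNReal.ofReal (|g (t (i + 1)) - g (t i)| ^ p)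

/-- The class `𝒲_p[a, b]` of functions with bounded `p`-variation on `[a, b]`. Functions on `[a, b]`
are represented by functions on `ℝ`, whose values off `[a, b]` play no role. -/
def boundedPVariation (p a b : ℝ) : Set (ℝ → ℝ) := {g | pVariation p g a b < ∞}

/-- Lebesgue measure on `[0, 1]`. -/
def lebesgueUnit : Measure ℝ := volume.restrict (Set.Icc 0 1)

/-- The space `𝓛²[0, 1]` of (honest) square-integrable functions. -/
abbrev SquareIntegrable : Type := {f : ℝ → ℝ // MemLp f 2 lebesgueUnit}

/-- An isonormal Gaussian process on `𝓛²[0, 1]`: a centred Gaussian process with covariance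
`E[ν(f) ν(h)] = ⟨f, h⟩ = ∫_0^1 f h dλ`. -/
structure IsIsonormalGaussianProcess {Ω : Type*} [MeasurableSpace Ω] (P : Measure Ω)
    (ν : SquareIntegrable → Ω → ℝ) : Prop where
  gaussian : IsGaussianProcess ν P
  centred : ∀ f, ∫ ω, ν f ω ∂P = 0
  covariance : ∀ f h, ∫ ω, ν f ω * ν h ω ∂P = ∫ x, f.1 x * h.1 x ∂lebesgueUnit

end

/-!
The proof is a reduction to sums of independent variables.

Write `S_n^j = n^{-1/2} ∑_{i=1}^n g(i/n) η_{i-j}`. The normalized sum of the process is the mixture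
`∑_j ψ_j S_n^j`. All delayed sums `S_n^j` are close to `S_n^0` in mean square: by summation by
parts, `S_n^{j+1} - S_n^j` is a weighted sum of the innovations whose weights are `n^{-1/2}` times
the increments `g((k+1)/n) - g(k/n)`, up to two boundary terms. The squares of these increments add
up to a quantity bounded in `n`, because bounded `q`-variation with `q ≤ 2` provides a bounded
monotone function `w` with `(g y - g x)² ≤ w y - w x` (`exists_isSqControl`). Hence
`‖S_n^j - S_n^0‖₂ = O(j n^{-1/2})`, and these norms are also bounded in `n` and `j`, so that
dominated convergence for `∑_j |ψ_j| ‖S_n^j - S_n^0‖₂` shows that the normalized sum differs from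
`A_ψ S_n^0` by a term tending to zero in `L²`
(`IsShortMemoryLinearProcess.eLpNorm_weightedSum_sub_le`, `tendsto_tsum_delayBound`).

The sum `S_n^0` has independent terms with bounded weights, and its characteristic function is
compared factor by factor with that of a normal variable with the same variance
(`tendstoInDistribution_weighted_sum`). The variances converge because the Riemann sums of `g²` do
(`IsSqControl.tendsto_riemannSum_sq`): `g` is continuous wherever the monotone `w` is, that is, off a
countable set. Slutsky's theorem combines the two parts.
-/

/-! ### Functions of bounded variation of order at most two -/

lemma sum_le_pVariation {p : ℝ} {g : ℝ → ℝ} {a b : ℝ} (m : ℕ) (t : ℕ → ℝ) (hm : 0 < m)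
    (h0 : t 0 = a) (hb : t m = b) (ht : ∀ i < m, t i < t (i + 1)) :
    ∑ i ∈ Finset.range m, ENNReal.ofReal (|g (t (i + 1)) - g (t i)| ^ p) ≤ pVariation p g a b :=
  le_iSup₂_of_le m t <| le_iSup_of_le ⟨hm, h0, hb, ht⟩ le_rfl

lemma ofReal_abs_sub_rpow_le_pVariation {p : ℝ} {g : ℝ → ℝ} {a b : ℝ} (hab : a < b) :
    ENNReal.ofReal (|g b - g a| ^ p) ≤ pVariation p g a b := by
  have := sum_le_pVariation (p := p) (g := g) (a := a) (b := b) 1 (fun i => if i = 0 then a else b)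
    one_pos (by simp) (by simp) (by simpa using hab)
  simpa using this

/-- On a degenerate interval there is no partition, so the supremum is over the empty set. -/
lemma pVariation_self (p : ℝ) (g : ℝ → ℝ) (a : ℝ) : pVariation p g a a = 0 := by
  refine le_antisymm (iSup₂_le fun m t => iSup_le ?_) zero_le
  rintro ⟨hm, h0, hb, ht⟩
  have h : ∀ k, k < m → t 0 < t (k + 1) := by
    intro k
    induction k with
    | zero => exact fun hk => ht 0 hk
    | succ k ih => exact fun hk => (ih (by omega)).trans (ht (k + 1) hk)
  have := h (m - 1) (by omega)
  rw [Nat.sub_add_cancel hm, h0, hb] at this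
  exact absurd this (lt_irrefl _)

/-- The `p`-variation is superadditive: a partition of `[a, x]` is extended by the point `y`. -/
lemma ofReal_add_pVariation_le {p : ℝ} {g : ℝ → ℝ} {a x y : ℝ} (hax : a ≤ x) (hxy : x < y) :
    ENNReal.ofReal (|g y - g x| ^ p) + pVariation p g a x ≤ pVariation p g a y := by
  rcases hax.eq_or_lt with rfl | hax
  · simpa [pVariation_self] using ofReal_abs_sub_rpow_le_pVariation hxy
  have key : ∀ (m : ℕ) (t : ℕ → ℝ), (0 < m ∧ t 0 = a ∧ t m = x ∧ ∀ i < m, t i < t (i + 1)) →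
      ENNReal.ofReal (|g y - g x| ^ p) +
        ∑ i ∈ Finset.range m, ENNReal.ofReal (|g (t (i + 1)) - g (t i)| ^ p) ≤
      pVariation p g a y := by
    rintro m t ⟨hm, h0, hx, ht⟩
    have := sum_le_pVariation (p := p) (g := g) (a := a) (b := y) (m + 1)
      (fun i => if i ≤ m then t i else y) (by omega) (by simpa using h0) (by simp) (by
        intro i hi
        rcases (Nat.lt_succ_iff.1 hi).eq_or_lt with rfl | hi'
        · simpa [hx] using hxy
        · simpa [hi'.le, Nat.succ_le_of_lt hi'] using ht i hi')
    refine le_trans (le_of_eq ?_) this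
    rw [Finset.sum_range_succ, add_comm]
    congr 1
    · refine Finset.sum_congr rfl fun i hi => ?_
      have hi' := Finset.mem_range.1 hi
      simp [hi'.le, Nat.succ_le_of_lt hi']
    · simp [hx]
  have hc : ENNReal.ofReal (|g y - g x| ^ p) ≤ pVariation p g a y :=
    le_self_add.trans (key 1 (fun i => if i = 0 then a else x) ⟨one_pos, by simp, by simp,
      by simpa using hax⟩)
  calc ENNReal.ofReal (|g y - g x| ^ p) + pVariation p g a x
      ≤ ENNReal.ofReal (|g y - g x| ^ p) +
          (pVariation p g a y - ENNReal.ofReal (|g y - g x| ^ p)) := by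
        gcongr
        refine iSup₂_le fun m t => iSup_le fun h => ?_
        refine ENNReal.le_sub_of_add_le_left ENNReal.ofReal_ne_top (key m t h)
    _ = pVariation p g a y := add_tsub_cancel_of_le hc

/-- A bounded monotone function `w` on the line controls the squared increments of `g` on `[0, 1]`.
This is the only trace of the `q`-variation of `g` that the limit theorem uses. -/
structure IsSqControl (w g : ℝ → ℝ) (V : ℝ) : Prop where
  monotone : Monotone w
  nonneg : ∀ x, 0 ≤ w x
  le : ∀ x, w x ≤ V
  sq_sub_le : ∀ x y, 0 ≤ x → x ≤ y → y ≤ 1 → (g y - g x) ^ 2 ≤ w y - w x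

/-- The control is a multiple of `x ↦ v_q(g; [0, x])`, frozen outside `[0, 1]`; the exponent `q` is
raised to `2` at the cost of a constant, because the increments of `g` are bounded. -/
lemma exists_isSqControl {q : ℝ} (hq1 : 1 ≤ q) (hq2 : q ≤ 2) {g : ℝ → ℝ}
    (hg : g ∈ boundedPVariation q 0 1) : ∃ w V, IsSqControl w g V := by
  have hfin : pVariation q g 0 1 ≠ ∞ := ne_of_lt hg
  have hmono1 : ∀ x y, 0 ≤ x → x ≤ y → pVariation q g 0 x ≤ pVariation q g 0 y := by
    intro x y hx hxy
    rcases hxy.eq_or_lt with rfl | h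
    · exact le_rfl
    · exact le_add_self.trans (ofReal_add_pVariation_le hx h)
  have hfin' : ∀ x, 0 ≤ x → x ≤ 1 → pVariation q g 0 x ≠ ∞ := fun x h0 h1 =>
    ne_top_of_le_ne_top hfin (hmono1 x 1 h0 h1)
  set V₀ : ℝ := (pVariation q g 0 1).toReal
  have hV0 : 0 ≤ V₀ := ENNReal.toReal_nonneg
  have hinc : ∀ x y, 0 ≤ x → x ≤ y → y ≤ 1 →
      |g y - g x| ^ q ≤ (pVariation q g 0 y).toReal - (pVariation q g 0 x).toReal := by
    intro x y h0 hxy h1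
    rcases hxy.eq_or_lt with rfl | h
    · simp [Real.zero_rpow (by linarith : q ≠ 0)]
    have h2 := ENNReal.toReal_mono (hfin' y (h0.trans hxy) h1)
      (ofReal_add_pVariation_le (p := q) (g := g) h0 h)
    rw [ENNReal.toReal_add ENNReal.ofReal_ne_top (hfin' x h0 (hxy.trans h1)),
      ENNReal.toReal_ofReal (by positivity)] at h2
    linarith
  set c : ℝ → ℝ := fun x => max 0 (min x 1) with hc
  have hc0 : ∀ x, 0 ≤ c x := fun x => le_max_left _ _
  have hc1 : ∀ x, c x ≤ 1 := fun x => max_le zero_le_one (min_le_right _ _)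
  have hcm : Monotone c := fun x y h => max_le_max le_rfl (min_le_min h le_rfl)
  have hce : ∀ x, 0 ≤ x → x ≤ 1 → c x = x := fun x h0 h1 => by simp [hc, h0, h1]
  set K : ℝ := (V₀ ^ q⁻¹) ^ (2 - q)
  have hK : 0 ≤ K := by positivity
  refine ⟨fun x => K * (pVariation q g 0 (c x)).toReal, K * V₀, ?_, ?_, ?_, ?_⟩
  · intro x y h
    exact mul_le_mul_of_nonneg_left
      (ENNReal.toReal_mono (hfin' _ (hc0 y) (hc1 y)) (hmono1 _ _ (hc0 x) (hcm h))) hK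
  · intro x
    positivity
  · intro x
    exact mul_le_mul_of_nonneg_left (ENNReal.toReal_mono hfin (hmono1 _ _ (hc0 x) (hc1 x))) hK
  · intro x y h0 hxy h1
    simp only [hce x h0 (hxy.trans h1), hce y (h0.trans hxy) h1, ← mul_sub]
    have h := hinc x y h0 hxy h1
    have hle : |g y - g x| ^ q ≤ V₀ := by
      refine h.trans ?_
      have := ENNReal.toReal_mono hfin (hmono1 y 1 (h0.trans hxy) h1)
      have := (pVariation q g 0 x).toReal_nonneg
      linarith
    have hq : 0 < q := by linarith
    have hle' : |g y - g x| ≤ V₀ ^ q⁻¹ := by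
      have := Real.rpow_le_rpow (by positivity) hle (inv_nonneg.2 hq.le)
      rwa [Real.rpow_rpow_inv (abs_nonneg _) hq.ne'] at this
    calc (g y - g x) ^ 2 = |g y - g x| ^ (2 - q) * |g y - g x| ^ q := by
          rw [← Real.rpow_add_of_nonneg (abs_nonneg _) (by linarith) hq.le]
          norm_num
      _ ≤ K * ((pVariation q g 0 y).toReal - (pVariation q g 0 x).toReal) := by
          refine mul_le_mul ?_ h (by positivity) hK
          exact Real.rpow_le_rpow (abs_nonneg _) hle' (by linarith)

lemma IsSqControl.abs_le {w g : ℝ → ℝ} {V : ℝ} (h : IsSqControl w g V) {x : ℝ} (h0 : 0 ≤ x)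
    (h1 : x ≤ 1) : |g x| ≤ |g 0| + √V := by
  have h2 := h.sq_sub_le 0 x le_rfl h0 h1
  have h3 : |g x - g 0| ≤ √V :=
    Real.abs_le_sqrt (h2.trans (by linarith [h.le x, h.nonneg 0]))
  linarith [abs_sub_abs_le_abs_sub (g x) (g 0)]

lemma IsSqControl.continuousAt {w g : ℝ → ℝ} {V : ℝ} (h : IsSqControl w g V) {x : ℝ} (h0 : 0 < x)
    (h1 : x < 1) (hw : ContinuousAt w x) : ContinuousAt g x := by
  have hb : ∀ᶠ y in 𝓝 x, |g y - g x| ≤ √|w y - w x| := by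
    filter_upwards [Ioo_mem_nhds h0 h1] with y hy
    refine Real.abs_le_sqrt ?_
    rcases le_total x y with hxy | hxy
    · exact (h.sq_sub_le x y h0.le hxy hy.2.le).trans (le_abs_self _)
    · rw [abs_sub_comm, ← neg_sub (g x), neg_sq]
      exact (h.sq_sub_le y x hy.1.le hxy h1.le).trans (le_abs_self _)
  have ht : Tendsto (fun y => √|w y - w x|) (𝓝 x) (𝓝 0) := by
    have : Tendsto (fun y => √|w y - w x|) (𝓝 x) (𝓝 (√|w x - w x|)) :=
      (Real.continuous_sqrt.comp continuous_abs).continuousAt.tendsto.comp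
        (hw.tendsto.sub_const (w x))
    simpa using this
  rw [ContinuousAt, tendsto_iff_norm_sub_tendsto_zero]
  exact squeeze_zero' (Eventually.of_forall fun _ => norm_nonneg _) hb ht

/-- The step function equal to `g (i / n)` on the cell `((i - 1) / n, i / n]`. -/
noncomputable def ceilStep (g : ℝ → ℝ) (n : ℕ) (x : ℝ) : ℝ := g (⌈(n : ℝ) * x⌉ / n)

lemma measurable_ceilStep (g : ℝ → ℝ) (n : ℕ) : Measurable (ceilStep g n) := by
  have h1 : Measurable fun k : ℤ => g ((k : ℝ) / n) := measurable_from_top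
  have h2 : Measurable fun x : ℝ => ⌈(n : ℝ) * x⌉ := Int.measurable_ceil.comp (by fun_prop)
  exact h1.comp h2

lemma tendsto_ceil_mul_div (x : ℝ) :
    Tendsto (fun n : ℕ => (⌈(n : ℝ) * x⌉ : ℝ) / n) atTop (𝓝 x) := by
  have hz : Tendsto (fun n : ℕ => x + 1 / (n : ℝ)) atTop (𝓝 (x + 0)) :=
    tendsto_const_nhds.add tendsto_one_div_atTop_nhds_zero_nat
  rw [add_zero] at hz
  refine tendsto_of_tendsto_of_tendsto_of_le_of_le' tendsto_const_nhds hz ?_ ?_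
  · filter_upwards [eventually_gt_atTop 0] with n hn
    have hn' : (0 : ℝ) < n := by exact_mod_cast hn
    rw [le_div_iff₀ hn', mul_comm]
    exact Int.le_ceil _
  · filter_upwards [eventually_gt_atTop 0] with n hn
    have hn' : (0 : ℝ) < n := by exact_mod_cast hn
    rw [div_le_iff₀ hn', add_mul, one_div_mul_cancel hn'.ne', mul_comm x]
    exact (Int.ceil_lt_add_one _).le

lemma ceil_mul_div_mem_Icc {n : ℕ} {x : ℝ} (hx : x ∈ Set.Icc (0 : ℝ) 1) :
    (⌈(n : ℝ) * x⌉ : ℝ) / n ∈ Set.Icc (0 : ℝ) 1 := by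
  have h0 : (0 : ℝ) ≤ n * x := mul_nonneg n.cast_nonneg hx.1
  refine ⟨div_nonneg (by exact_mod_cast Int.ceil_nonneg h0) n.cast_nonneg,
    div_le_one_of_le₀ ?_ n.cast_nonneg⟩
  have : ⌈(n : ℝ) * x⌉ ≤ (n : ℤ) :=
    Int.ceil_le.2 (by simpa using mul_le_of_le_one_right n.cast_nonneg hx.2)
  exact_mod_cast this

lemma IsSqControl.ae_tendsto_ceilStep {w g : ℝ → ℝ} {V : ℝ} (h : IsSqControl w g V) :
    ∀ᵐ x ∂lebesgueUnit, Tendsto (fun n => ceilStep g n x) atTop (𝓝 (g x)) := by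
  have hS : (volume.restrict (Set.Icc (0 : ℝ) 1))
      ({x | ¬ ContinuousAt w x} ∪ {0, 1} : Set ℝ) = 0 :=
    ((h.monotone.countable_not_continuousAt.union (Set.toFinite _).countable)).measure_zero _
  have hS' := measure_eq_zero_iff_ae_notMem.1 hS
  filter_upwards [hS', ae_restrict_mem measurableSet_Icc] with x hx hmem
  simp only [Set.mem_union, Set.mem_ofPred_eq, Set.mem_insert_iff, Set.mem_singleton_iff,
    not_or, not_not] at hx
  have hc := h.continuousAt (lt_of_le_of_ne hmem.1 (Ne.symm hx.2.1))
    (lt_of_le_of_ne hmem.2 hx.2.2) hx.1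
  exact hc.tendsto.comp (tendsto_ceil_mul_div x)

instance : IsFiniteMeasure lebesgueUnit := by
  unfold lebesgueUnit
  infer_instance

lemma IsSqControl.memLp {w g : ℝ → ℝ} {V : ℝ} (h : IsSqControl w g V) (p : ℝ≥0∞) :
    MemLp g p lebesgueUnit := by
  refine MemLp.of_bound (aemeasurable_of_tendsto_metrizable_ae atTop
    (fun n => (measurable_ceilStep g n).aemeasurable) h.ae_tendsto_ceilStep).aestronglyMeasurable
    (|g 0| + √V) ?_
  filter_upwards [ae_restrict_mem measurableSet_Icc] with x hx
  exact h.abs_le hx.1 hx.2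

lemma sum_Icc_one_eq_sum_range {α : Type*} [AddCommMonoid α] (f : ℕ → α) (n : ℕ) :
    ∑ i ∈ Finset.Icc 1 n, f i = ∑ k ∈ Finset.range n, f (k + 1) := by
  induction n with
  | zero => simp
  | succ n ih => rw [Finset.sum_Icc_succ_top (by omega), ih, Finset.sum_range_succ]

lemma integral_ceilStep_sq (g : ℝ → ℝ) {n : ℕ} (hn : n ≠ 0) :
    ∫ x, ceilStep g n x ^ 2 ∂lebesgueUnit =
      (n : ℝ)⁻¹ * ∑ i ∈ Finset.Icc 1 n, g ((i : ℝ) / n) ^ 2 := by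
  have hn' : (0 : ℝ) < n := by positivity
  have hcell : ∀ k : ℕ, Set.EqOn (fun x => ceilStep g n x ^ 2)
      (fun _ => g (((k + 1 : ℕ) : ℝ) / n) ^ 2) (Set.Ioc ((k : ℝ) / n) (((k + 1 : ℕ) : ℝ) / n)) := by
    intro k x hx
    have : ⌈(n : ℝ) * x⌉ = (k + 1 : ℕ) := by
      rw [Int.ceil_eq_iff]
      have h1 := (div_lt_iff₀ hn').1 hx.1
      have h2 := (le_div_iff₀ hn').1 hx.2
      push_cast at *
      constructor <;> linarith
    simp [ceilStep, this]
  have hle : ∀ k : ℕ, (k : ℝ) / n ≤ ((k + 1 : ℕ) : ℝ) / n := fun k => by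
    gcongr
    exact_mod_cast k.le_succ
  have h1 : ∫ x, ceilStep g n x ^ 2 ∂lebesgueUnit =
      ∫ x in (((0 : ℕ) : ℝ) / n)..((n : ℝ) / n), ceilStep g n x ^ 2 := by
    rw [div_self hn'.ne', Nat.cast_zero, zero_div, intervalIntegral.integral_of_le zero_le_one,
      lebesgueUnit, integral_Icc_eq_integral_Ioc]
  rw [h1, ← intervalIntegral.sum_integral_adjacent_intervals (a := fun k : ℕ => (k : ℝ) / n),
    sum_Icc_one_eq_sum_range, Finset.mul_sum]
  · refine Finset.sum_congr rfl fun k _ => ?_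
    rw [intervalIntegral.integral_of_le (hle k),
      setIntegral_congr_fun measurableSet_Ioc (hcell k), setIntegral_const, smul_eq_mul,
      Measure.real, Real.volume_Ioc, ENNReal.toReal_ofReal (by linarith [hle k])]
    push_cast
    ring
  · intro k _
    rw [intervalIntegrable_iff_integrableOn_Ioc_of_le (hle k),
      integrableOn_congr_fun (hcell k) measurableSet_Ioc]
    exact integrableOn_const (by simp)

/-- Convergence of the Riemann sums of `g²`, by dominated convergence for the step functions. -/
lemma IsSqControl.tendsto_riemannSum_sq {w g : ℝ → ℝ} {V : ℝ} (h : IsSqControl w g V) :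
    Tendsto (fun n : ℕ => (n : ℝ)⁻¹ * ∑ i ∈ Finset.Icc 1 n, g ((i : ℝ) / n) ^ 2) atTop
      (𝓝 (∫ x, g x ^ 2 ∂lebesgueUnit)) := by
  have hlim : Tendsto (fun n : ℕ => ∫ x, ceilStep g n x ^ 2 ∂lebesgueUnit) atTop
      (𝓝 (∫ x, g x ^ 2 ∂lebesgueUnit)) := by
    refine tendsto_integral_of_dominated_convergence (fun _ => (|g 0| + √V) ^ 2)
      (fun n => ((measurable_ceilStep g n).pow_const 2).aestronglyMeasurable)
      (integrable_const _) (fun n => ?_) ?_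
    · filter_upwards [ae_restrict_mem measurableSet_Icc] with x hx
      have hm := ceil_mul_div_mem_Icc (n := n) hx
      rw [Real.norm_eq_abs, abs_pow]
      exact pow_le_pow_left₀ (abs_nonneg _) (h.abs_le hm.1 hm.2) 2
    · filter_upwards [h.ae_tendsto_ceilStep] with x hx
      exact hx.pow 2
  refine hlim.congr' ?_
  filter_upwards [eventually_ne_atTop 0] with n hn
  exact integral_ceilStep_sq g hn

/-! ### A central limit theorem with bounded deterministic weights -/

lemma norm_prod_sub_prod_le_sum {ι : Type*} (s : Finset ι) (z w : ι → ℂ) (hz : ∀ i ∈ s, ‖z i‖ ≤ 1)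
    (hw : ∀ i ∈ s, ‖w i‖ ≤ 1) :
    ‖∏ i ∈ s, z i - ∏ i ∈ s, w i‖ ≤ ∑ i ∈ s, ‖z i - w i‖ := by
  classical
  induction s using Finset.induction_on with
  | empty => simp
  | insert a s ha ih =>
    rw [Finset.prod_insert ha, Finset.prod_insert ha, Finset.sum_insert ha]
    have ih' := ih (fun i hi => hz i (Finset.mem_insert_of_mem hi))
      (fun i hi => hw i (Finset.mem_insert_of_mem hi))
    have h1 : ‖∏ i ∈ s, z i‖ ≤ 1 := by
      rw [norm_prod]
      exact Finset.prod_le_one (fun _ _ => norm_nonneg _)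
        (fun i hi => hz i (Finset.mem_insert_of_mem hi))
    calc ‖z a * ∏ i ∈ s, z i - w a * ∏ i ∈ s, w i‖
        = ‖(z a - w a) * ∏ i ∈ s, z i + w a * (∏ i ∈ s, z i - ∏ i ∈ s, w i)‖ := by ring_nf
      _ ≤ ‖z a - w a‖ * 1 + 1 * ‖∏ i ∈ s, z i - ∏ i ∈ s, w i‖ := by
          refine (norm_add_le _ _).trans ?_
          rw [norm_mul, norm_mul]
          gcongr
          exact hw a (Finset.mem_insert_self _ _)
      _ ≤ _ := by linarith

/-- A centred standardized variable and the standard normal law have characteristic functions with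
the same second order expansion at `0`. -/
lemma charFun_sub_exp_isLittleO {Ω : Type*} [MeasurableSpace Ω] {P : Measure Ω}
    [IsProbabilityMeasure P] {ξ : Ω → ℝ} (hξ : AEMeasurable ξ P) (h0 : ∫ ω, ξ ω ∂P = 0)
    (h1 : ∫ ω, ξ ω ^ 2 ∂P = 1) :
    (fun t : ℝ => charFun (P.map ξ) t - Complex.exp (-(t ^ 2 / 2 : ℝ))) =o[𝓝 0]
      fun t : ℝ => t ^ 2 := by
  have hA := taylor_charFun_two hξ h0 (by simpa using h1)
  have hB := taylor_charFun_two (P := gaussianReal 0 1) (X := id) aemeasurable_id (by simp) (by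
    have := variance_id_gaussianReal (μ := 0) (v := 1)
    rw [variance_eq_integral aemeasurable_id] at this
    simpa using this)
  refine (hA.sub hB).congr_left fun t => ?_
  rw [Measure.map_id, charFun_gaussianReal]
  push_cast
  simp

/-- Central limit theorem for triangular arrays of weights: the proof compares, factor by factor,
the characteristic function of the sum with that of a normal variable of the same variance. -/
theorem tendstoInDistribution_weighted_sum {Ω Ω' : Type*} [MeasurableSpace Ω] [MeasurableSpace Ω']
    {P : Measure Ω} [IsProbabilityMeasure P] {P' : Measure Ω'} [IsProbabilityMeasure P']
    {ι : Type*} {ξ : ι → Ω → ℝ} {ξ₀ : Ω → ℝ} (hindep : iIndepFun ξ P)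
    (hident : ∀ i, IdentDistrib (ξ i) ξ₀ P P) (h0 : ∫ ω, ξ₀ ω ∂P = 0) (h1 : ∫ ω, ξ₀ ω ^ 2 ∂P = 1)
    {s : ℕ → Finset ι} (hs : ∀ n, (s n).card = n) {c : ℕ → ι → ℝ} {M : ℝ}
    (hc : ∀ n, ∀ i ∈ s n, |c n i| ≤ M) {v : NNReal}
    (hv : Tendsto (fun n : ℕ => (n : ℝ)⁻¹ * ∑ i ∈ s n, c n i ^ 2) atTop (𝓝 v))
    {Z : Ω' → ℝ} (hZ : HasLaw Z (gaussianReal 0 v) P') :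
    TendstoInDistribution (fun (n : ℕ) ω => (√(n : ℝ))⁻¹ * ∑ i ∈ s n, c n i * ξ i ω) atTop Z
      (fun _ => P) P' := by
  have hm : ∀ i, AEMeasurable (ξ i) P := fun i => (hident i).aemeasurable_fst
  obtain ⟨i₁, hi₁⟩ : (s 1).Nonempty := Finset.card_pos.1 (by rw [hs]; exact one_pos)
  have hm0 : AEMeasurable ξ₀ P := (hident i₁).aemeasurable_snd
  have hM : 0 ≤ M := (abs_nonneg _).trans (hc 1 i₁ hi₁)
  have hms : ∀ n, AEMeasurable (fun ω => ∑ i ∈ s n, c n i * ξ i ω) P := fun n =>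
    Finset.aemeasurable_fun_sum _ fun i _ => (hm i).const_mul _
  refine ⟨fun n => (hms n).const_mul _, hZ.aemeasurable, ?_⟩
  have : IsProbabilityMeasure (P.map ξ₀) := Measure.isProbabilityMeasure_map hm0
  refine ProbabilityMeasure.tendsto_iff_tendsto_charFun.2 fun t => ?_
  set φ := charFun (P.map ξ₀)
  set u : ℕ → ι → ℝ := fun n i => c n i * ((√(n : ℝ))⁻¹ * t) with hu
  have hchar : ∀ n : ℕ, charFun (P.map fun ω => (√(n : ℝ))⁻¹ * ∑ i ∈ s n, c n i * ξ i ω) t =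
      ∏ i ∈ s n, φ (u n i) := by
    intro n
    have hind : iIndepFun (fun i ω => c n i * ξ i ω) P :=
      hindep.comp (fun i x => c n i * x) (fun i => by fun_prop)
    rw [charFun_map_mul_comp (hms n), (hind.restrict _).charFun_map_fun_finsetSum_eq_prod
      (fun i _ => (hm i).const_mul _), Finset.prod_apply]
    refine Finset.prod_congr rfl fun i _ => ?_
    rw [charFun_map_mul_comp (hm i), (hident i).map_eq]
  have hexp : Tendsto (fun n : ℕ => ∏ i ∈ s n, Complex.exp (-(u n i ^ 2 / 2 : ℝ))) atTop
      (𝓝 (charFun (gaussianReal 0 v) t)) := by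
    have he : ∀ᶠ n : ℕ in atTop,
        Complex.exp (-(t ^ 2 / 2 * ((n : ℝ)⁻¹ * ∑ i ∈ s n, c n i ^ 2) : ℝ)) =
        ∏ i ∈ s n, Complex.exp (-(u n i ^ 2 / 2 : ℝ)) := by
      filter_upwards with n
      rw [← Complex.exp_sum]
      congr 1
      rw [Finset.sum_neg_distrib, ← Complex.ofReal_sum]
      congr 2
      rw [Finset.mul_sum, Finset.mul_sum]
      refine Finset.sum_congr rfl fun i _ => ?_
      simp only [hu, mul_pow, inv_pow, Real.sq_sqrt n.cast_nonneg]
      ring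
    refine Tendsto.congr' he ?_
    rw [charFun_gaussianReal]
    have h2 := (hv.const_mul (t ^ 2 / 2)).neg
    have h3 := (Complex.continuous_exp.tendsto _).comp ((Complex.continuous_ofReal.tendsto _).comp h2)
    convert! h3 using 2
    · simp [Function.comp_def]
    · push_cast
      ring_nf
  have hdiff : Tendsto (fun n : ℕ => ∏ i ∈ s n, φ (u n i) -
      ∏ i ∈ s n, Complex.exp (-(u n i ^ 2 / 2 : ℝ))) atTop (𝓝 0) := by
    rw [Metric.tendsto_atTop']
    intro ε hε
    -- every factor differs by at most `δ u²`, and the `u²` add up to at most `M² t²`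
    set δ : ℝ := ε / (2 * (M ^ 2 * t ^ 2 + 1)) with hδ
    have hδ0 : 0 < δ := by positivity
    have hlit := (charFun_sub_exp_isLittleO hm0 h0 h1).def hδ0
    obtain ⟨r, hr, hball⟩ := Metric.eventually_nhds_iff.1 hlit
    have hsmall : Tendsto (fun n : ℕ => M * ((√(n : ℝ))⁻¹ * |t|)) atTop (𝓝 0) := by
      have : Tendsto (fun n : ℕ => M * ((√(n : ℝ))⁻¹ * |t|)) atTop (𝓝 (M * (0 * |t|))) :=
        ((tendsto_inv_atTop_zero.comp (Real.tendsto_sqrt_atTop.comp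
          tendsto_natCast_atTop_atTop)).mul_const _).const_mul _
      simpa using this
    obtain ⟨N, hN⟩ := eventually_atTop.1 (hsmall.eventually (gt_mem_nhds hr))
    refine ⟨N, fun n hn => ?_⟩
    have hub : ∀ i ∈ s n, |u n i| ≤ M * ((√(n : ℝ))⁻¹ * |t|) := by
      intro i hi
      simp only [hu, abs_mul, abs_inv, abs_of_nonneg (Real.sqrt_nonneg _)]
      gcongr
      exact hc n i hi
    have husq : ∀ i ∈ s n, u n i ^ 2 ≤ M ^ 2 * ((n : ℝ)⁻¹ * t ^ 2) := by
      intro i hi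
      have := pow_le_pow_left₀ (abs_nonneg _) (hub i hi) 2
      simpa only [sq_abs, mul_pow, inv_pow, Real.sq_sqrt n.cast_nonneg] using this
    rw [dist_zero_right]
    calc ‖∏ i ∈ s n, φ (u n i) - ∏ i ∈ s n, Complex.exp (-(u n i ^ 2 / 2 : ℝ))‖
        ≤ ∑ i ∈ s n, ‖φ (u n i) - Complex.exp (-(u n i ^ 2 / 2 : ℝ))‖ := by
          refine norm_prod_sub_prod_le_sum _ _ _ (fun i _ => norm_charFun_le_one _) fun i _ => ?_
          rw [← Complex.ofReal_neg, Complex.norm_exp_ofReal, Real.exp_le_one_iff]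
          exact neg_nonpos.2 (by positivity)
      _ ≤ ∑ i ∈ s n, δ * (M ^ 2 * ((n : ℝ)⁻¹ * t ^ 2)) := by
          refine Finset.sum_le_sum fun i hi => ?_
          have hd : dist (u n i) 0 < r := by
            rw [dist_zero_right, Real.norm_eq_abs]
            exact (hub i hi).trans_lt (hN n hn.le)
          refine (hball hd).trans ?_
          rw [Real.norm_eq_abs, abs_of_nonneg (sq_nonneg _)]
          exact mul_le_mul_of_nonneg_left (husq i hi) hδ0.le
      _ ≤ δ * (M ^ 2 * t ^ 2) := by
          rw [Finset.sum_const, hs, nsmul_eq_mul]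
          have hn1 : (n : ℝ) * (n : ℝ)⁻¹ ≤ 1 := mul_inv_le_one
          calc (n : ℝ) * (δ * (M ^ 2 * ((n : ℝ)⁻¹ * t ^ 2)))
              = (n * (n : ℝ)⁻¹) * (δ * (M ^ 2 * t ^ 2)) := by ring
            _ ≤ 1 * (δ * (M ^ 2 * t ^ 2)) := by gcongr
            _ = _ := one_mul _
      _ < ε := by
          rw [hδ, div_mul_eq_mul_div, div_lt_iff₀ (by positivity)]
          nlinarith [mul_nonneg (sq_nonneg M) (sq_nonneg t)]
  have := hdiff.add hexp
  simp only [sub_add_cancel, zero_add] at this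
  simp only [ProbabilityMeasure.coe_mk, hchar, hZ.map_eq]
  exact this

/-! ### Mean-square estimates for weighted sums of the innovations -/

section

variable {Ω : Type*} [MeasurableSpace Ω] {P : Measure Ω} {η : ℤ → Ω → ℝ}

lemma IsInnovation.memLp (h : IsInnovation P η) (j : ℤ) : MemLp (η j) 2 P :=
  (h.identDistrib j).memLp_iff.2 h.memLp_two

lemma IsInnovation.aemeasurable (h : IsInnovation P η) (j : ℤ) : AEMeasurable (η j) P :=
  (h.identDistrib j).aemeasurable_fst

lemma IsInnovation.integral_eq_zero (h : IsInnovation P η) (j : ℤ) : ∫ ω, η j ω ∂P = 0 :=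
  (h.identDistrib j).integral_eq.trans h.mean_zero

lemma sq_innovationStd (P : Measure Ω) (η : ℤ → Ω → ℝ) :
    innovationStd P η ^ 2 = ∫ ω, η 1 ω ^ 2 ∂P :=
  Real.sq_sqrt (integral_nonneg fun _ => sq_nonneg _)

lemma IsInnovation.innovationStd_ne_zero (h : IsInnovation P η) : innovationStd P η ≠ 0 := by
  intro h0
  have := sq_innovationStd P η
  rw [h0] at this
  exact h.second_moment_ne_zero (by simpa using this.symm)

lemma IsInnovation.variance_eq (h : IsInnovation P η) (j : ℤ) :
    Var[η j; P] = innovationStd P η ^ 2 := by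
  rw [(h.identDistrib j).variance_eq, sq_innovationStd,
    variance_of_integral_eq_zero (h.aemeasurable 1) h.mean_zero]

/-- Independent centred variables are orthogonal in `L²`. -/
lemma IsInnovation.eLpNorm_sum [IsProbabilityMeasure P] (h : IsInnovation P η) {ι : Type*}
    (s : Finset ι) (a : ι → ℝ) {e : ι → ℤ} (he : Function.Injective e) :
    eLpNorm (fun ω => ∑ k ∈ s, a k * η (e k) ω) 2 P =
      ENNReal.ofReal (innovationStd P η * √(∑ k ∈ s, a k ^ 2)) := by
  have hm : ∀ k ∈ s, MemLp (fun ω => a k * η (e k) ω) 2 P := fun k _ =>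
    (h.memLp (e k)).const_mul (a k)
  have hsum : MemLp (fun ω => ∑ k ∈ s, a k * η (e k) ω) 2 P := memLp_finsetSum s hm
  have h0 : ∫ ω, ∑ k ∈ s, a k * η (e k) ω ∂P = 0 := by
    rw [integral_finsetSum _ fun k hk => (hm k hk).integrable (by norm_num)]
    exact Finset.sum_eq_zero fun k _ => by rw [integral_const_mul, h.integral_eq_zero, mul_zero]
  have hvar : Var[fun ω => ∑ k ∈ s, a k * η (e k) ω; P] =
      innovationStd P η ^ 2 * ∑ k ∈ s, a k ^ 2 := by
    have := IndepFun.variance_sum (s := s) (X := fun k ω => a k * η (e k) ω) hm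
      (fun i _ j _ hij => (h.indep.indepFun (he.ne hij)).comp
        (measurable_const_mul (a i)) (measurable_const_mul (a j)))
    rw [Finset.sum_fn] at this
    rw [this, Finset.mul_sum]
    refine Finset.sum_congr rfl fun k _ => ?_
    rw [variance_const_mul, h.variance_eq, mul_comm]
  rw [variance_of_integral_eq_zero hsum.aestronglyMeasurable.aemeasurable h0] at hvar
  rw [hsum.eLpNorm_eq_integral_rpow_norm (by norm_num) (by norm_num)]
  congr 1
  have h2 : ∀ ω, ‖∑ k ∈ s, a k * η (e k) ω‖ ^ (2 : ℝ≥0∞).toReal =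
      (∑ k ∈ s, a k * η (e k) ω) ^ 2 := fun ω => by
    simp
  simp_rw [h2, hvar]
  rw [ENNReal.toReal_ofNat, ← one_div, ← Real.sqrt_eq_rpow, Real.sqrt_mul (sq_nonneg _),
    Real.sqrt_sq (by exact Real.sqrt_nonneg _)]

/-- The weights `g (i / n)`, `1 ≤ i ≤ n`, extended by zero. -/
noncomputable def zeroExtWeight (g : ℝ → ℝ) (n k : ℕ) : ℝ :=
  if 1 ≤ k ∧ k ≤ n then g ((k : ℝ) / n) else 0

/-- Summation by parts: shifting the innovations by one amounts to differencing the weights. -/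
lemma weightedSum_shift_succ_sub {Ω : Type*} (η : ℤ → Ω → ℝ) (g : ℝ → ℝ) (n : ℕ) (j : ℤ) (ω : Ω) :
    weightedSum (fun i => η (i - (j + 1))) g n ω - weightedSum (fun i => η (i - j)) g n ω =
      ∑ k ∈ Finset.range (n + 1),
        (zeroExtWeight g n (k + 1) - zeroExtWeight g n k) * η ((k : ℤ) - j) ω := by
  simp_rw [sub_mul, Finset.sum_sub_distrib]
  congr 1
  · rw [Finset.sum_range_succ, weightedSum, sum_Icc_one_eq_sum_range]
    have h0 : zeroExtWeight g n (n + 1) = 0 := by simp [zeroExtWeight]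
    rw [h0, zero_mul, add_zero]
    refine Finset.sum_congr rfl fun k hk => ?_
    have hk' := Finset.mem_range.1 hk
    have : ((k + 1 : ℕ) : ℤ) - (j + 1) = k - j := by push_cast; ring
    rw [this, zeroExtWeight, if_pos (by omega), mul_comm]
  · rw [Finset.sum_range_succ', weightedSum, sum_Icc_one_eq_sum_range]
    have h0 : zeroExtWeight g n 0 = 0 := by simp [zeroExtWeight]
    rw [h0, zero_mul, add_zero]
    refine Finset.sum_congr rfl fun k hk => ?_
    have hk' := Finset.mem_range.1 hk
    rw [zeroExtWeight, if_pos (by omega), mul_comm]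

lemma natCast_div_mem_Icc {n i : ℕ} (hi : i ≤ n) : (i : ℝ) / n ∈ Set.Icc (0 : ℝ) 1 :=
  ⟨by positivity, div_le_one_of_le₀ (by exact_mod_cast hi) n.cast_nonneg⟩

/-- The differenced weights have square sum bounded in `n`: the two ends contribute the size of
`g`, the other terms telescope through the control. -/
lemma IsSqControl.sum_sq_sub_zeroExtWeight_le {w g : ℝ → ℝ} {V : ℝ} (h : IsSqControl w g V)
    {n : ℕ} (hn : n ≠ 0) :
    ∑ k ∈ Finset.range (n + 1), (zeroExtWeight g n (k + 1) - zeroExtWeight g n k) ^ 2 ≤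
      2 * (|g 0| + √V) ^ 2 + V := by
  set M := |g 0| + √V
  have hgM : ∀ i : ℕ, i ≤ n → g ((i : ℝ) / n) ^ 2 ≤ M ^ 2 := fun i hi => by
    have hm := natCast_div_mem_Icc hi
    rw [← sq_abs (g _)]
    exact pow_le_pow_left₀ (abs_nonneg _) (h.abs_le hm.1 hm.2) 2
  have hmono : ∀ k : ℕ, w ((k : ℝ) / n) ≤ w (((k + 1 : ℕ) : ℝ) / n) := fun k =>
    h.monotone (by gcongr; exact k.le_succ)
  have hterm : ∀ k ∈ Finset.range (n + 1),
      (zeroExtWeight g n (k + 1) - zeroExtWeight g n k) ^ 2 ≤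
        ((if k = 0 then M ^ 2 else 0) + (if k = n then M ^ 2 else 0)) +
          (w (((k + 1 : ℕ) : ℝ) / n) - w ((k : ℝ) / n)) := by
    intro k hk
    have hk' : k ≤ n := Nat.lt_succ_iff.1 (Finset.mem_range.1 hk)
    have hw := hmono k
    rcases Nat.eq_zero_or_pos k with rfl | hpos
    · have h1 := hgM 1 (by omega)
      rw [zeroExtWeight, if_pos (by omega), zeroExtWeight, if_neg (by omega), sub_zero, if_pos rfl,
        if_neg (Ne.symm hn)]
      linarith
    rcases hk'.eq_or_lt with rfl | hlt
    · have h1 := hgM k le_rfl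
      rw [zeroExtWeight, if_neg (by omega), zeroExtWeight, if_pos (by omega), zero_sub, neg_sq,
        if_pos rfl, if_neg hn]
      linarith
    · rw [zeroExtWeight, if_pos (by omega), zeroExtWeight, if_pos (by omega), if_neg hpos.ne',
        if_neg hlt.ne, add_zero, zero_add]
      refine h.sq_sub_le _ _ (natCast_div_mem_Icc hk').1 ?_ (natCast_div_mem_Icc hlt).2
      gcongr
      exact k.le_succ
  refine (Finset.sum_le_sum hterm).trans ?_
  rw [Finset.sum_add_distrib, Finset.sum_add_distrib,
    Finset.sum_range_sub (fun k : ℕ => w ((k : ℝ) / n)), Finset.sum_ite_eq', Finset.sum_ite_eq',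
    if_pos (by simp), if_pos (by simp)]
  linarith [h.le (((n + 1 : ℕ) : ℝ) / n), h.nonneg (((0 : ℕ) : ℝ) / n)]

/-- The normalized weighted sum `n^{-1/2} ∑ g (i / n) η_{i - j}` of the innovations delayed
by `j`. -/
noncomputable def delayedSum (η : ℤ → Ω → ℝ) (g : ℝ → ℝ) (n : ℕ) (j : ℤ) (ω : Ω) : ℝ :=
  (√(n : ℝ))⁻¹ * weightedSum (fun i => η (i - j)) g n ω

lemma IsInnovation.aemeasurable_delayedSum (hη : IsInnovation P η) (g : ℝ → ℝ) (n : ℕ) (j : ℤ) :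
    AEMeasurable (delayedSum η g n j) P :=
  (Finset.aemeasurable_fun_sum _ fun _ _ => (hη.aemeasurable _).mul_const _).const_mul _

lemma eLpNorm_inv_sqrt_mul {f : Ω → ℝ} {σ S : ℝ} (n : ℕ)
    (hf : eLpNorm f 2 P = ENNReal.ofReal (σ * √S)) :
    eLpNorm (fun ω => (√(n : ℝ))⁻¹ * f ω) 2 P = ENNReal.ofReal (σ * √(S / n)) := by
  have : (fun ω => (√(n : ℝ))⁻¹ * f ω) = (√(n : ℝ))⁻¹ • f := rfl
  rw [this, eLpNorm_const_smul, hf, Real.enorm_of_nonneg (by positivity),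
    ← ENNReal.ofReal_mul (by positivity), Real.sqrt_div' _ n.cast_nonneg]
  congr 1
  ring

lemma eLpNorm_delayedSum_le [IsProbabilityMeasure P] (hη : IsInnovation P η) {w g : ℝ → ℝ} {V : ℝ}
    (h : IsSqControl w g V) (n : ℕ) (j : ℤ) :
    eLpNorm (delayedSum η g n j) 2 P ≤
      ENNReal.ofReal (innovationStd P η * (|g 0| + √V)) := by
  have hσ : 0 ≤ innovationStd P η := Real.sqrt_nonneg _
  have h1 := hη.eLpNorm_sum (Finset.Icc 1 n) (fun i : ℕ => g ((i : ℝ) / n))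
    (e := fun i : ℕ => (i : ℤ) - j) (fun a b hab => by simpa using hab)
  have h2 := eLpNorm_inv_sqrt_mul n h1
  have h3 : delayedSum η g n j = fun ω => (√(n : ℝ))⁻¹ *
      ∑ i ∈ Finset.Icc 1 n, g ((i : ℝ) / n) * η ((i : ℤ) - j) ω := by
    ext ω
    simp only [delayedSum, weightedSum, mul_comm]
  rw [h3, h2]
  refine ENNReal.ofReal_le_ofReal (mul_le_mul_of_nonneg_left (Real.sqrt_le_iff.2
    ⟨by positivity, ?_⟩) hσ)
  refine div_le_of_le_mul₀ n.cast_nonneg (sq_nonneg _) ?_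
  calc ∑ i ∈ Finset.Icc 1 n, g ((i : ℝ) / n) ^ 2
      ≤ ∑ i ∈ Finset.Icc 1 n, (|g 0| + √V) ^ 2 := by
        refine Finset.sum_le_sum fun i hi => ?_
        have hm := natCast_div_mem_Icc (Finset.mem_Icc.1 hi).2
        rw [← sq_abs (g _)]
        exact pow_le_pow_left₀ (abs_nonneg _) (h.abs_le hm.1 hm.2) 2
    _ = (|g 0| + √V) ^ 2 * n := by simp [mul_comm]

lemma eLpNorm_delayedSum_succ_sub_le [IsProbabilityMeasure P] (hη : IsInnovation P η)
    {w g : ℝ → ℝ} {V : ℝ} (h : IsSqControl w g V) {n : ℕ} (hn : n ≠ 0) (j : ℤ) :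
    eLpNorm (delayedSum η g n (j + 1) - delayedSum η g n j) 2 P ≤
      ENNReal.ofReal (innovationStd P η * √((2 * (|g 0| + √V) ^ 2 + V) / n)) := by
  have hσ : 0 ≤ innovationStd P η := Real.sqrt_nonneg _
  have h1 := hη.eLpNorm_sum (Finset.range (n + 1))
    (fun k => zeroExtWeight g n (k + 1) - zeroExtWeight g n k)
    (e := fun i : ℕ => (i : ℤ) - j) (fun a b hab => by simpa using hab)
  have h2 := eLpNorm_inv_sqrt_mul n h1
  have h3 : delayedSum η g n (j + 1) - delayedSum η g n j = fun ω => (√(n : ℝ))⁻¹ *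
      ∑ k ∈ Finset.range (n + 1),
        (zeroExtWeight g n (k + 1) - zeroExtWeight g n k) * η ((k : ℤ) - j) ω := by
    ext ω
    rw [← weightedSum_shift_succ_sub, Pi.sub_apply, delayedSum, delayedSum, mul_sub]
  rw [h3, h2]
  gcongr
  exact h.sum_sq_sub_zeroExtWeight_le hn

/-- A bound for the `L²` distance between the sums delayed by `j` and by `0`: it vanishes as
`n → ∞` for each `j`, and is bounded in `n` and `j`. -/
noncomputable def delayBound (σ M V : ℝ) (n j : ℕ) : ℝ :=
  min (σ * M + σ * M) (j * (σ * √((2 * M ^ 2 + V) / n)))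

lemma eLpNorm_delayedSum_sub_zero_le [IsProbabilityMeasure P] (hη : IsInnovation P η)
    {w g : ℝ → ℝ} {V : ℝ} (h : IsSqControl w g V) {n : ℕ} (hn : n ≠ 0) (j : ℕ) :
    eLpNorm (delayedSum η g n j - delayedSum η g n 0) 2 P ≤
      ENNReal.ofReal (delayBound (innovationStd P η) (|g 0| + √V) V n j) := by
  have hσ : 0 ≤ innovationStd P η := Real.sqrt_nonneg _
  have hm : ∀ j : ℤ, AEStronglyMeasurable (delayedSum η g n j) P := fun j =>
    (hη.aemeasurable_delayedSum g n j).aestronglyMeasurable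
  rw [delayBound, ENNReal.ofReal_min]
  refine le_min ?_ ?_
  · rw [ENNReal.ofReal_add (by positivity) (by positivity)]
    exact (eLpNorm_sub_le (hm _) (hm _) (by norm_num)).trans
      (add_le_add (eLpNorm_delayedSum_le hη h n j) (eLpNorm_delayedSum_le hη h n 0))
  · induction j with
    | zero => simp
    | succ j ih =>
      have heq : delayedSum η g n ((j + 1 : ℕ) : ℤ) - delayedSum η g n 0 =
          (delayedSum η g n ((j : ℤ) + 1) - delayedSum η g n j) +
            (delayedSum η g n j - delayedSum η g n 0) := by
        push_cast
        abel
      rw [heq, Nat.cast_succ, add_mul, one_mul, add_comm (_ * _),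
        ENNReal.ofReal_add (by positivity) (by positivity)]
      exact (eLpNorm_add_le ((hm _).sub (hm _)) ((hm _).sub (hm _)) (by norm_num)).trans
        (add_le_add (eLpNorm_delayedSum_succ_sub_le hη h hn j) ih)

lemma tendsto_tsum_delayBound {σ M V : ℝ} (hσ : 0 ≤ σ) (hM : 0 ≤ M) {ψ : ℕ → ℝ}
    (hψ : Summable fun j => |ψ j|) :
    Tendsto (fun n : ℕ => ∑' j, |ψ j| * delayBound σ M V n j) atTop (𝓝 0) := by
  have h := tendsto_tsum_of_dominated_convergence (𝓕 := atTop)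
    (f := fun n j => |ψ j| * delayBound σ M V n j) (g := fun _ => (0 : ℝ))
    (bound := fun j => |ψ j| * (σ * M + σ * M)) (hψ.mul_right _) ?_ ?_
  · simpa using h
  · intro j
    have h1 : Tendsto (fun n : ℕ => √((2 * M ^ 2 + V) / n)) atTop (𝓝 (√0)) :=
      (Real.continuous_sqrt.tendsto 0).comp (tendsto_const_div_atTop_nhds_zero_nat _)
    have h2 : Tendsto (fun n : ℕ => delayBound σ M V n j) atTop
        (𝓝 (min (σ * M + σ * M) (j * (σ * √0)))) :=
      tendsto_const_nhds.min ((h1.const_mul σ).const_mul _)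
    have h3 : min (σ * M + σ * M) (j * (σ * √0)) = 0 := by
      simp only [Real.sqrt_zero, mul_zero]
      exact min_eq_right (by positivity)
    rw [h3] at h2
    simpa using h2.const_mul |ψ j|
  · refine Eventually.of_forall fun n j => ?_
    have h0 : 0 ≤ delayBound σ M V n j := le_min (by positivity) (by positivity)
    rw [Real.norm_eq_abs, abs_of_nonneg (by positivity)]
    exact mul_le_mul_of_nonneg_left (min_le_left _ _) (abs_nonneg _)

/-! ### Replacing the linear process by its innovations -/

variable {ψ : ℕ → ℝ} {X : ℤ → Ω → ℝ}

lemma IsLinearProcess.aemeasurable (hX : IsLinearProcess P η ψ X) (i : ℤ) :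
    AEMeasurable (X i) P :=
  aemeasurable_of_tendsto_metrizable_ae atTop
    (fun _ => Finset.aemeasurable_fun_sum _ fun _ _ =>
      (hX.innovation.aemeasurable _).const_mul _) (hX.series i)

lemma IsLinearProcess.aemeasurable_weightedSum (hX : IsLinearProcess P η ψ X) (g : ℝ → ℝ) (n : ℕ) :
    AEMeasurable (fun ω => (√(n : ℝ))⁻¹ * weightedSum X g n ω) P :=
  (Finset.aemeasurable_fun_sum _ fun _ _ => (hX.aemeasurable _).mul_const _).const_mul _

/-- The weighted sum of the process is the mixture, with weights `ψ_j`, of the delayed sums of the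
innovations, so its `L²` distance to `A_ψ` times the undelayed sum is at most the mixture of the
distances. Fatou's lemma passes from the partial sums of the series to its limit. -/
lemma IsShortMemoryLinearProcess.eLpNorm_weightedSum_sub_le [IsProbabilityMeasure P]
    (hX : IsShortMemoryLinearProcess P η ψ X) {w g : ℝ → ℝ} {V : ℝ} (h : IsSqControl w g V)
    {n : ℕ} (hn : n ≠ 0) :
    eLpNorm (fun ω => (√(n : ℝ))⁻¹ * weightedSum X g n ω - filterSum ψ * delayedSum η g n 0 ω)
      2 P ≤
      ENNReal.ofReal (∑' j, |ψ j| * delayBound (innovationStd P η) (|g 0| + √V) V n j) := by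
  have hη := hX.innovation
  set σ := innovationStd P η
  have hσ : 0 ≤ σ := Real.sqrt_nonneg _
  set M := |g 0| + √V
  have hm : ∀ j : ℤ, AEStronglyMeasurable (delayedSum η g n j) P := fun j =>
    (hη.aemeasurable_delayedSum g n j).aestronglyMeasurable
  have hb0 : ∀ j, 0 ≤ delayBound σ M V n j := fun j => le_min (by positivity) (by positivity)
  have hsummable : Summable fun j => |ψ j| * delayBound σ M V n j := by
    refine Summable.of_nonneg_of_le (fun j => mul_nonneg (abs_nonneg _) (hb0 j)) (fun j => ?_)
      (hX.summable.mul_right (σ * M + σ * M))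
    exact mul_le_mul_of_nonneg_left (min_le_left _ _) (abs_nonneg _)
  let D : ℕ → Ω → ℝ := fun N =>
    ∑ j ∈ Finset.range N, ψ j • (delayedSum η g n j - delayedSum η g n 0)
  have hDm : ∀ j : ℕ,
      AEStronglyMeasurable (ψ j • (delayedSum η g n j - delayedSum η g n 0)) P := fun j =>
    ((hm _).sub (hm _)).const_smul _
  have hD : ∀ N, eLpNorm (D N) 2 P ≤ ENNReal.ofReal (∑' j, |ψ j| * delayBound σ M V n j) := by
    intro N
    calc eLpNorm (D N) 2 P
        ≤ ∑ j ∈ Finset.range N, eLpNorm (ψ j • (delayedSum η g n j - delayedSum η g n 0)) 2 P :=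
          eLpNorm_sum_le (fun j _ => hDm j) (by norm_num)
      _ ≤ ∑ j ∈ Finset.range N, ENNReal.ofReal (|ψ j| * delayBound σ M V n j) := by
          refine Finset.sum_le_sum fun j _ => ?_
          rw [eLpNorm_const_smul, Real.enorm_eq_ofReal_abs, ENNReal.ofReal_mul (abs_nonneg _)]
          gcongr
          exact eLpNorm_delayedSum_sub_zero_le hη h hn j
      _ = ENNReal.ofReal (∑ j ∈ Finset.range N, |ψ j| * delayBound σ M V n j) :=
          (ENNReal.ofReal_sum_of_nonneg fun j _ => mul_nonneg (abs_nonneg _) (hb0 j)).symm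
      _ ≤ _ := ENNReal.ofReal_le_ofReal
          (hsummable.sum_le_tsum _ fun j _ => mul_nonneg (abs_nonneg _) (hb0 j))
  have hlim : ∀ᵐ ω ∂P, Tendsto (fun N => D N ω) atTop
      (𝓝 ((√(n : ℝ))⁻¹ * weightedSum X g n ω - filterSum ψ * delayedSum η g n 0 ω)) := by
    filter_upwards [ae_all_iff.2 hX.series] with ω hω
    have hDω : ∀ N, D N ω = (√(n : ℝ))⁻¹ * (∑ i ∈ Finset.Icc 1 n,
        (∑ j ∈ Finset.range N, ψ j * η ((i : ℤ) - j) ω) * g ((i : ℝ) / n)) -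
          (∑ j ∈ Finset.range N, ψ j) * delayedSum η g n 0 ω := by
      intro N
      simp only [D, Finset.sum_apply, Pi.smul_apply, Pi.sub_apply, smul_eq_mul, mul_sub,
        Finset.sum_sub_distrib, Finset.sum_mul]
      congr 1
      rw [Finset.sum_comm, Finset.mul_sum]
      refine Finset.sum_congr rfl fun j _ => ?_
      rw [delayedSum, weightedSum, mul_left_comm, Finset.mul_sum]
      simp only [mul_assoc]
    simp only [hDω]
    have hψ : Tendsto (fun N => ∑ j ∈ Finset.range N, ψ j) atTop (𝓝 (filterSum ψ)) :=
      (summable_abs_iff.1 hX.summable).hasSum.tendsto_sum_nat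
    have hsum := tendsto_finsetSum (Finset.Icc 1 n)
      fun (i : ℕ) _ => (hω (i : ℤ)).mul_const (g ((i : ℝ) / n))
    exact (hsum.const_mul _).sub (hψ.mul_const _)
  refine (Lp.eLpNorm_lim_le_liminf_eLpNorm
    (fun N => Finset.aestronglyMeasurable_sum _ fun j _ => hDm j) _ hlim).trans ?_
  exact liminf_le_of_frequently_le' (Frequently.of_forall hD)

end

/-! ### Convergence to the isonormal process -/

lemma IsIsonormalGaussianProcess.hasLaw {Ω : Type*} [MeasurableSpace Ω] {P : Measure Ω}
    {ν : SquareIntegrable → Ω → ℝ} (hν : IsIsonormalGaussianProcess P ν) (f : SquareIntegrable) :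
    HasLaw (ν f) (gaussianReal 0 (∫ x, f.1 x ^ 2 ∂lebesgueUnit).toNNReal) P := by
  have hg := hν.gaussian.hasGaussianLaw_eval f
  refine ⟨hg.aemeasurable, ?_⟩
  rw [hg.map_eq_gaussianReal, hν.centred f,
    variance_of_integral_eq_zero hg.aemeasurable (hν.centred f)]
  have := hν.covariance f f
  simp only [← sq] at this
  rw [this]

theorem mainTheorem5 {Ω Ω' : Type*} [MeasurableSpace Ω] [MeasurableSpace Ω']
    (P : Measure Ω) [IsProbabilityMeasure P] (P' : Measure Ω') [IsProbabilityMeasure P']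
    (η : ℤ → Ω → ℝ) (ψ : ℕ → ℝ) (X : ℤ → Ω → ℝ) (hX : IsShortMemoryLinearProcess P η ψ X)
    (ν : SquareIntegrable → Ω' → ℝ) (hν : IsIsonormalGaussianProcess P' ν)
    (q : ℝ) (hq1 : 1 ≤ q) (hq2 : q < 2) (g : ℝ → ℝ) (hg : g ∈ boundedPVariation q 0 1) :
    ∃ hg2 : MemLp g 2 lebesgueUnit,
      TendstoInDistribution (fun (n : ℕ) ω => (√(n : ℝ))⁻¹ * weightedSum X g n ω) atTop
        (fun ω' => innovationStd P η * filterSum ψ * ν ⟨g, hg2⟩ ω') (fun _ => P) P' ∧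
      HasLaw (fun ω' => innovationStd P η * filterSum ψ * ν ⟨g, hg2⟩ ω')
        (gaussianReal 0 (Real.toNNReal
          (innovationStd P η ^ 2 * filterSum ψ ^ 2 * ∫ x, g x ^ 2 ∂lebesgueUnit))) P' := by

  obtain ⟨w, V, hw⟩ := exists_isSqControl hq1 hq2.le hg
  have hg2 : MemLp g 2 lebesgueUnit := hw.memLp 2
  have hη := hX.innovation
  set σ := innovationStd P η
  have hσ : σ ≠ 0 := hη.innovationStd_ne_zero
  have hσ0 : 0 ≤ σ := Real.sqrt_nonneg _
  have hνg := hν.hasLaw ⟨g, hg2⟩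
  have hI : 0 ≤ ∫ x, g x ^ 2 ∂lebesgueUnit := integral_nonneg fun _ => sq_nonneg _
  refine ⟨hg2, ?_, ?_⟩
  · -- the central limit theorem for the standardized innovations
    have hclt := tendstoInDistribution_weighted_sum (P := P) (P' := P') (ι := ℕ)
      (ξ := fun i ω => σ⁻¹ * η i ω) (ξ₀ := fun ω => σ⁻¹ * η 1 ω)
      ((hη.indep.precomp Nat.cast_injective).comp (fun _ x => σ⁻¹ * x) fun _ => by fun_prop)
      (fun i => (hη.identDistrib i).const_mul σ⁻¹)
      (by rw [integral_const_mul, hη.mean_zero, mul_zero])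
      (by
        simp only [mul_pow]
        rw [integral_const_mul, ← sq_innovationStd, ← mul_pow, inv_mul_cancel₀ hσ, one_pow])
      (s := fun n => Finset.Icc 1 n) (fun n => by simp)
      (c := fun n i => g ((i : ℝ) / n)) (M := |g 0| + √V)
      (fun n i hi => by
        have hm := natCast_div_mem_Icc (Finset.mem_Icc.1 hi).2
        exact hw.abs_le hm.1 hm.2)
      (v := (∫ x, g x ^ 2 ∂lebesgueUnit).toNNReal)
      (by rw [Real.coe_toNNReal _ hI]; exact hw.tendsto_riemannSum_sq) hνg
    have hlim : TendstoInDistribution (fun n ω => filterSum ψ * delayedSum η g n 0 ω) atTop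
        (fun ω' => σ * filterSum ψ * ν ⟨g, hg2⟩ ω') (fun _ => P) P' := by
      have h1 := hclt.continuous_comp (g := fun x => σ * filterSum ψ * x) (by fun_prop)
      refine h1.congr (fun n => ae_of_all _ fun ω => ?_) (ae_of_all _ fun _ => rfl)
      simp only [Function.comp_apply, delayedSum, weightedSum, sub_zero,
        Finset.mul_sum]
      refine Finset.sum_congr rfl fun i _ => ?_
      field_simp
    refine tendstoInDistribution_of_tendstoInMeasure_sub _ _ hlim ?_
      (fun n => hX.aemeasurable_weightedSum g n)
    refine tendstoInMeasure_of_tendsto_eLpNorm (p := 2) (by norm_num)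
      (fun n => ((hX.aemeasurable_weightedSum g n).sub
        (hlim.forall_aemeasurable n)).aestronglyMeasurable) aestronglyMeasurable_zero ?_
    simp only [sub_zero]
    have hbound := (ENNReal.continuous_ofReal.tendsto 0).comp
      (tendsto_tsum_delayBound (M := |g 0| + √V) (V := V) hσ0 (by positivity) hX.summable)
    rw [ENNReal.ofReal_zero] at hbound
    refine tendsto_of_tendsto_of_tendsto_of_le_of_le' tendsto_const_nhds hbound
      (Eventually.of_forall fun _ => zero_le) ?_
    filter_upwards [eventually_ne_atTop 0] with n hn
    exact hX.eLpNorm_weightedSum_sub_le hw hn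
  · have h := gaussianReal_const_mul hνg (σ * filterSum ψ)
    convert h using 2
    · simp
    · ext
      simp only [NNReal.coe_mul, NNReal.coe_mk]
      rw [Real.coe_toNNReal _ (by positivity), Real.coe_toNNReal _ hI, mul_pow]
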